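/- **Setting.** A stochastic graph $G=(U,V,E)$ is a finite bipartite graph, $E=U\times V$ (missing edges have probability $0$), with weights $w_e\ge 0$ and probabilities $p_e\in[0,1]$; each edge $e$ is active independently with probability $p_e$, and its state is revealed only by probing it. Each online vertex $v\in V$ has a probing constraint $\mathcal C_v$: a non-empty set of strings of distinct edges at $v$ that is closed under taking substrings (subsequences) and permutations. $G$ is *vertex-weighted* if there are $(w_u)_{u\in U}$ with $w_{u,v}=w_u$ for all $(u,v)\in E$. An *offline probing algorithm* adaptively (and possibly with randomization) probes edges in any order such that, for each $v$, the string of edges probed at $v$ lies in $\mathcal C_v$; if a probed edge is active, the algorithm must decide irrevocably, before the next probe, whether to include it, and the included edges must form a matching. $\mathrm{OPT}(G)$ is the supremum over these algorithms of the expected weight of the matching. For $s\in V$ and $R\subseteq U$, let $\mathrm{OPT}(s,R)$ be the value of $\mathrm{OPT}$ on the induced stochastic graph $G[\{s\}\cup R]$, and for a string $\boldsymbol e=(e_1,\dots,e_k)\in\mathcal C_s$ let $$\mathrm{val}(\boldsymbol e)=\sum_{i=1}^{k}p_{e_i}w_{e_i}\prod_{j<i}(1-p_{e_j}).$$ *DP-OPT*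 is a procedure that returns, for given $s$ and $R$, a string $\boldsymbol e\in\mathcal C_s$ using only edges of $R\times\{s\}$ with $\mathrm{val}(\boldsymbol e)=\mathrm{OPT}(s,R)$. *Greedy-DP* starts with $R=U$ and $\mathcal M=\emptyset$. When $v\in V$ arrives, it probes the edges of the string returned by DP-OPT for $(v,R)$ in order, until the first active edge $(u,v)$ is found (if any), which it adds to $\mathcal M$, removing $u$ from $R$. At the end it returns $\mathcal M$. **Theorem.** Let $G$ be a vertex-weighted stochastic graph whose online vertices arrive in an arbitrary (adversarially chosen) order. 1. For all $s\in V$, $R\subseteq U$ the following dynamic program is a valid implementation of DP-OPT: go through the edges of $R\times\{s\}$ in non-increasing order of weight and find, by recursion on whether the next edge is appended to the string built so far (allowed only if the result is in $\mathcal C_s$) or skipped, a continuation of maximum $\mathrm{val}$. 2. For every implementation of DP-OPT (whichever optimal string it returns for each pair $(s,R)$), Greedy-DP returns a matching $\mathcal M$ of active edges, for every outcome of the edge states, and $$\mathbb E[w(\mathcal M)]\ \ge\ \tfrac12\,\mathrm{OPT}(G),$$ where $w(\mathcal M)=\sum_{e\in\mathcal M}w_e$ and the expectation is over the edge states. -/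

import Mathlib

open scoped List

noncomputable section

namespace StochMatch

/-- A stochastic graph `G = (U, V, E)` with offline vertices `U`, online vertices `V` and
`E = U × V` (missing edges are edges of probability `0`). Every edge `e` has a weight `w e ≥ 0` and
a probability `p e`. The online probing constraint `C v` is a set of strings of distinct edges
at `v`; the edge `(u, v)` of such a string is recorded by its offline endpoint `u`. -/
structure StochasticGraph (U V : Type*) where
  /-- edge weights -/
  w : U × V → ℝ
  w_nonneg : ∀ e, 0 ≤ w e
  /-- edge probabilities -/
  p : U × V → ℝ
  p_nonneg : ∀ e, 0 ≤ p e
  p_le_one : ∀ e, p e ≤ 1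
  /-- online probing constraints -/
  C : V → Set (List U)
  C_nodup : ∀ v, ∀ l ∈ C v, l.Nodup
  C_nonempty : ∀ v, (C v).Nonempty
  /-- downward closed: substrings and permutations of members are members
  (`l' <+~ l` says that `l'` is a permutation of a subsequence of `l`) -/
  C_down : ∀ v, ∀ l ∈ C v, ∀ l', l' <+~ l → l' ∈ C v

/-- A deterministic adaptive probing procedure: either halt, or probe the edge `e` and go on
according to its revealed state. If `e` is active, it is put into the matching, irrevocably and
before any further probe, exactly when `commit = true`. -/
inductive ProbeTree (U V : Type*) where
  | done : ProbeTree U V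
  | probe (e : U × V) (commit : Bool) (ifActive ifInactive : ProbeTree U V) : ProbeTree U V

/-- A set of edges no two of which share an endpoint. -/
def IsMatching {U V : Type*} (M : Finset (U × V)) : Prop :=
  ∀ e ∈ M, ∀ f ∈ M, e ≠ f → e.1 ≠ f.1 ∧ e.2 ≠ f.2

/-- The string of edges at `v` among the edges probed so far, in the order of the probes. -/
def stringAt {U V : Type*} [DecidableEq V] (v : V) (probed : List (U × V)) : List U :=
  (probed.filter (fun e => decide (e.2 = v))).map Prod.fst

/-- The matching produced by a probing procedure when the edge states are `st`. -/
def ProbeTree.run {U V : Type*} [DecidableEq U] [DecidableEq V] (st : U × V → Bool) :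
    ProbeTree U V → Finset (U × V)
  | .done => ∅
  | .probe e commit a i =>
      if st e = true then
        (if commit = true then insert e (ProbeTree.run st a) else ProbeTree.run st a)
      else ProbeTree.run st i

namespace StochasticGraph

variable {U V : Type*}

/-- `G` is (offline) vertex-weighted. -/
def IsVertexWeighted (G : StochasticGraph U V) : Prop :=
  ∃ a : U → ℝ, ∀ u v, G.w (u, v) = a u

/-- The weight of a set of edges. -/
def weight (G : StochasticGraph U V) (M : Finset (U × V)) : ℝ := ∑ e ∈ M, G.w e

/-- Expectation over the edge states: the edges are active independently, `e` with
probability `p e`. -/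
def expect [Fintype U] [DecidableEq U] [Fintype V] [DecidableEq V] (G : StochasticGraph U V)
    (f : (U × V → Bool) → ℝ) : ℝ :=
  ∑ st : U × V → Bool, (∏ e : U × V, if st e = true then G.p e else 1 - G.p e) * f st

/-- `G.Admissible T probed M`: started after the edges of `probed` have been probed (in this order)
and those of `M` have been matched, `T` respects all the probing constraints, and it only ever
commits to an edge whose two endpoints are still unmatched. -/
def Admissible [DecidableEq U] [DecidableEq V] (G : StochasticGraph U V) :
    ProbeTree U V → List (U × V) → Finset (U × V) → Prop
  | .done, _, _ => True
  | .probe e commit a i, probed, M =>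
      stringAt e.2 (probed ++ [e]) ∈ G.C e.2 ∧
      (commit = true → ∀ f ∈ M, f.1 ≠ e.1 ∧ f.2 ≠ e.2) ∧
      Admissible G a (probed ++ [e]) (if commit = true then insert e M else M) ∧
      Admissible G i (probed ++ [e]) M

/-- Deterministic offline probing algorithms for `G`. -/
def DetOfflineAlg [DecidableEq U] [DecidableEq V] (G : StochasticGraph U V) :=
  {T : ProbeTree U V // G.Admissible T [] ∅}

section benchmark

variable [Fintype U] [DecidableEq U] [Fintype V] [DecidableEq V]

/-- Expected weight of the matching returned by a randomized offline probing algorithm, that is,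
by a random deterministic one, drawn independently of the edge states. -/
def performance (G : StochasticGraph U V) (A : PMF G.DetOfflineAlg) : ℝ :=
  ∑' T : G.DetOfflineAlg, (A T).toReal * G.expect (fun st => G.weight (T.1.run st))

/-- The offline adaptive benchmark `OPT(G)`. -/
def OPT (G : StochasticGraph U V) : ℝ := ⨆ A : PMF G.DetOfflineAlg, G.performance A

end benchmark

/-- The induced stochastic graph `G[R ∪ S]`. -/
def induce (G : StochasticGraph U V) (R : Finset U) (S : Finset V) :
    StochasticGraph {u // u ∈ R} {v // v ∈ S} where
  w e := G.w (e.1.1, e.2.1)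
  w_nonneg _ := G.w_nonneg _
  p e := G.p (e.1.1, e.2.1)
  p_nonneg _ := G.p_nonneg _
  p_le_one _ := G.p_le_one _
  C v := {l | l.map Subtype.val ∈ G.C v.1}
  C_nodup v l hl := List.Nodup.of_map _ (G.C_nodup v.1 _ hl)
  C_nonempty v := by
    obtain ⟨l, hl⟩ := G.C_nonempty v.1
    exact ⟨[], G.C_down v.1 l hl _ (List.nil_subperm)⟩
  C_down v l hl l' h := by
    obtain ⟨k, hk, hs⟩ := h
    exact G.C_down v.1 _ hl _ ⟨k.map _, hk.map _, hs.map _⟩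

/-- `OPT(s, R)`: the adaptive benchmark of `G[{s} ∪ R]`. -/
def optStar [DecidableEq U] [DecidableEq V] (G : StochasticGraph U V) (s : V) (R : Finset U) : ℝ :=
  (G.induce R {s}).OPT

/-- `val(e)`: the expected weight of the first active edge when the edges at `s` of the string `l`
are probed in order. -/
def val (G : StochasticGraph U V) (s : V) (l : List U) : ℝ :=
  ∑ i : Fin l.length, G.p (l.get i, s) * G.w (l.get i, s) *
    ((l.take i).map (fun u => 1 - G.p (u, s))).prod

/-- What DP-OPT has to return on `G[{s} ∪ R]`: a string of `C s` using only edges of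
`R × {s}`, of value `OPT(s, R)`. -/
def IsOptimalString [DecidableEq U] [DecidableEq V] (G : StochasticGraph U V) (s : V)
    (R : Finset U) (l : List U) : Prop :=
  l ∈ G.C s ∧ (∀ u ∈ l, u ∈ R) ∧ G.val s l = G.optStar s R

open Classical in
/-- The dynamic program: given the edges `chosen` already put into the string, find the best
continuation by a subsequence of the given list. -/
def dpAux (G : StochasticGraph U V) (s : V) (chosen : List U) : List U → List U
  | [] => []
  | u :: us =>
      let skip := dpAux G s chosen us
      let take := u :: dpAux G s (chosen ++ [u]) us
      if chosen ++ [u] ∈ G.C s ∧ G.val s skip ≤ G.val s take then take else skip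

open Classical in
/-- DP-OPT: run the dynamic program on the edges of `R × {s}` in non-increasing order of
weight. -/
def dpOpt (G : StochasticGraph U V) (s : V) (R : Finset U) : List U :=
  dpAux G s [] (R.toList.insertionSort (fun a b => G.w (b, s) ≤ G.w (a, s)))

end StochasticGraph

/-- Greedy-DP, with `D s R` as the string returned by DP-OPT on `G[{s} ∪ R]`: the online vertices
arrive in the order of the list, `R` is the set of the currently unmatched offline vertices, and
the edge states are `st`. The arriving vertex `v` probes the edges of `D v R` in order until
the first active one, which is added to the matching. -/
def greedyDP {U V : Type*} [DecidableEq U] [DecidableEq V] (D : V → Finset U → List U)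
    (st : U × V → Bool) : List V → Finset U → Finset (U × V)
  | [], _ => ∅
  | v :: vs, R =>
      match (D v R).find? (fun u => st (u, v)) with
      | none => greedyDP D st vs R
      | some u => insert (u, v) (greedyDP D st vs (R.erase u))

namespace StochasticGraph

variable {U V : Type*} [Fintype U] [DecidableEq U] [Fintype V] [DecidableEq V]

theorem sum_prob (G : StochasticGraph U V) :
    ∑ st : U × V → Bool, (∏ e : U × V, if st e = true then G.p e else 1 - G.p e) = 1 := by
  have h := Finset.prod_univ_sum (fun _ : U × V => (Finset.univ : Finset Bool))
    (fun e b => if b = true then G.p e else 1 - G.p e)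
  rw [Fintype.piFinset_univ] at h
  rw [← h]
  simp

theorem expect_le (G : StochasticGraph U V) (f : (U × V → Bool) → ℝ) (c : ℝ)
    (h : ∀ st, f st ≤ c) : G.expect f ≤ c := by
  have h1 : G.expect f ≤ G.expect (fun _ => c) := by
    refine Finset.sum_le_sum fun st _ => mul_le_mul_of_nonneg_left (h st) ?_
    refine Finset.prod_nonneg fun e _ => ?_
    split_ifs
    · exact G.p_nonneg e
    · linarith [G.p_le_one e]
  refine h1.trans (le_of_eq ?_)
  rw [expect, ← Finset.sum_mul, sum_prob, one_mul]

/-- The supremum in `OPT` is over a bounded set. -/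
theorem bddAbove_performance (G : StochasticGraph U V) :
    BddAbove (Set.range G.performance) := by
  refine ⟨G.weight Finset.univ, ?_⟩
  rintro _ ⟨A, rfl⟩
  have hW : 0 ≤ G.weight Finset.univ := Finset.sum_nonneg fun e _ => G.w_nonneg e
  have hs : HasSum (fun T => (A T).toReal) 1 := by
    have h := ENNReal.hasSum_toReal (f := A) (by rw [A.tsum_coe]; simp)
    rwa [← ENNReal.tsum_toReal_eq (fun T => A.apply_ne_top T), A.tsum_coe,
      ENNReal.toReal_one] at h
  have hs' := hs.mul_right (G.weight Finset.univ)
  rw [one_mul] at hs'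
  refine (tsum_le_of_sum_le' hW fun F => ?_)
  refine le_trans (Finset.sum_le_sum fun T _ => ?_)
    (sum_le_hasSum F (fun T _ => mul_nonneg ENNReal.toReal_nonneg hW) hs')
  refine mul_le_mul_of_nonneg_left (G.expect_le _ _ fun st => ?_) ENNReal.toReal_nonneg
  exact Finset.sum_le_sum_of_subset_of_nonneg (Finset.subset_univ _) fun e _ _ => G.w_nonneg e

end StochasticGraph

end StochMatch

end

/-! An adaptive procedure gains nothing at a single online vertex. By induction on the probe tree,
the expected weight it collects on `R × {v}` is at most `val` of one allowed string
(`exists_string_weightAt_le`). Conversely, probing a string until its first active edge earns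
exactly its `val` (`expect_weight_chain`). So `OPT(s, R)` is the maximum of `val` over strings in
`R`. An exchange argument lets the maximum be sought among strings sorted by weight, which the
dynamic program searches.

For the ratio, fix an offline algorithm and let `o u v` be the probability that it matches `(u, v)`.
Then `∑ v, o u v ≤ 1`, and the star bound gives `∑ u ∈ R, a u * o u v ≤ OPT(v, R)` for every `R`.
Induct over the arrivals, for all `R` (`sum_le_two_mul_expect_greedyDP`). The arriving vertex earns
`OPT(v, R)` in expectation, which pays for its own terms of the fractional matching. Removing the
matched `u` destroys at most `a u` of the later terms, since weights depend on `u` only, and the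
gain `a u` pays for this a second time; hence the factor 2. -/

namespace StochMatch

namespace StochasticGraph

/-! ### Values of strings and the dynamic program -/

section value

variable {U V : Type*} (G : StochasticGraph U V)

@[simp] theorem val_nil (s : V) : G.val s [] = 0 := by simp [val]

theorem val_cons (s : V) (u : U) (l : List U) :
    G.val s (u :: l) = G.p (u, s) * G.w (u, s) + (1 - G.p (u, s)) * G.val s l := by
  unfold val
  rw [Finset.mul_sum]
  refine (Fin.sum_univ_succ (n := l.length) _).trans ?_
  congr 1
  · simp
  · refine Finset.sum_congr rfl fun i _ => ?_
    simp only [List.get_eq_getElem, Fin.val_succ, List.getElem_cons_succ, List.take_succ_cons,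
      List.map_cons, List.prod_cons]
    ring

theorem val_nonneg (s : V) (l : List U) : 0 ≤ G.val s l := by
  induction l with
  | nil => simp
  | cons u l ih =>
    rw [val_cons]
    have h1 := mul_nonneg (G.p_nonneg (u, s)) (G.w_nonneg (u, s))
    have h2 := mul_nonneg (sub_nonneg.2 (G.p_le_one (u, s))) ih
    linarith

theorem val_cons_le_val_cons (s : V) (u : U) {l l' : List U} (h : G.val s l ≤ G.val s l') :
    G.val s (u :: l) ≤ G.val s (u :: l') := by
  rw [val_cons, val_cons]
  have := mul_le_mul_of_nonneg_left h (sub_nonneg.2 (G.p_le_one (u, s)))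
  linarith

/-- Moving an edge of maximal weight to the front does not decrease the value. -/
theorem val_append_cons_le (s : V) (u : U) (l₁ l₂ : List U)
    (h : ∀ x ∈ l₁, G.w (x, s) ≤ G.w (u, s)) :
    G.val s (l₁ ++ u :: l₂) ≤ G.val s (u :: (l₁ ++ l₂)) := by
  induction l₁ with
  | nil => simp
  | cons x l₁ ih =>
    refine (G.val_cons_le_val_cons s x (ih fun y hy => h y (by simp [hy]))).trans ?_
    simp only [List.cons_append, val_cons]
    -- Swapping adjacent `x`, `u` changes the value by `p_x p_u (w_u - w_x)`.
    have h1 := mul_nonneg (mul_nonneg (G.p_nonneg (x, s)) (G.p_nonneg (u, s)))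
      (sub_nonneg.2 (h x (by simp)))
    linarith

/-- Among the orderings of a string, those by non-increasing weight have the largest value. -/
theorem val_le_of_perm_sorted (s : V) {l l' : List U} (hp : l ~ l')
    (hs : l'.Pairwise (fun a b => G.w (b, s) ≤ G.w (a, s))) : G.val s l ≤ G.val s l' := by
  induction l' generalizing l with
  | nil => rw [hp.eq_nil]
  | cons u l' ih =>
    obtain ⟨l₁, l₂, rfl⟩ := List.append_of_mem (hp.mem_iff.2 (by simp : u ∈ u :: l'))
    have hp' : l₁ ++ l₂ ~ l' := (List.perm_middle.symm.trans hp).cons_inv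
    rw [List.pairwise_cons] at hs
    refine (G.val_append_cons_le s u l₁ l₂ fun x hx => ?_).trans
      (G.val_cons_le_val_cons s u (ih hp' hs.2))
    exact hs.1 x (hp'.mem_iff.1 (by simp [hx]))

theorem nil_mem_C (s : V) : [] ∈ G.C s := by
  obtain ⟨l, hl⟩ := G.C_nonempty s
  exact G.C_down s l hl _ List.nil_subperm

theorem dpAux_sublist (s : V) (us chosen : List U) : (G.dpAux s chosen us).Sublist us := by
  induction us generalizing chosen with
  | nil => simp [dpAux]
  | cons u us ih =>
    simp only [dpAux]
    split_ifs
    · exact (ih _).cons_cons u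
    · exact (ih _).cons u

theorem append_dpAux_mem (s : V) (us chosen : List U) (h : chosen ∈ G.C s) :
    chosen ++ G.dpAux s chosen us ∈ G.C s := by
  induction us generalizing chosen with
  | nil => simpa [dpAux] using h
  | cons u us ih =>
    simp only [dpAux]
    split_ifs with hc
    · simpa using ih _ hc.1
    · exact ih _ h

/-- The DP's choice at each edge dominates both alternatives, because prefixing an edge is monotone
in the value of the continuation. -/
theorem val_le_val_dpAux (s : V) (us chosen l : List U) (hl : l.Sublist us)
    (h : chosen ++ l ∈ G.C s) : G.val s l ≤ G.val s (G.dpAux s chosen us) := by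
  induction us generalizing chosen l with
  | nil => simp [List.sublist_nil.1 hl, dpAux]
  | cons u us ih =>
    simp only [dpAux]
    rcases hl with _ | hl | hl
    · rename_i hl
      have := ih chosen l hl h
      split_ifs with hc
      · exact this.trans hc.2
      · exact this
    · rename_i l hl
      have hu : chosen ++ [u] ∈ G.C s :=
        G.C_down s _ h _ (List.Sublist.subperm (by simp))
      have := G.val_cons_le_val_cons s u (ih (chosen ++ [u]) l hl (by simpa using h))
      split_ifs with hc
      · exact this
      -- Appending `u` is allowed here, so the DP skipped it only because skipping is at least as
      -- good.
      · exact this.trans (le_of_not_ge fun h' => hc ⟨hu, h'⟩)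

theorem dpOpt_mem_C (s : V) (R : Finset U) : G.dpOpt s R ∈ G.C s := by
  exact G.append_dpAux_mem s _ [] (G.nil_mem_C s)

theorem mem_of_mem_dpOpt (s : V) (R : Finset U) : ∀ u ∈ G.dpOpt s R, u ∈ R := by
  intro u hu
  simpa using (G.dpAux_sublist s _ _).subset hu

theorem val_le_val_dpOpt (s : V) (R : Finset U) {l : List U} (hl : l ∈ G.C s)
    (hR : ∀ u ∈ l, u ∈ R) : G.val s l ≤ G.val s (G.dpOpt s R) := by
  classical
  set r : U → U → Prop := fun a b => G.w (b, s) ≤ G.w (a, s) with hr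
  have : Std.Total r := ⟨fun a b => le_total _ _⟩
  have : IsTrans U r := ⟨fun a b c h1 h2 => le_trans h2 h1⟩
  set m := R.toList.insertionSort r with hm
  have hsort : m.Pairwise r := List.pairwise_insertionSort r _
  have hnd : m.Nodup := (List.perm_insertionSort r _).nodup_iff.2 R.nodup_toList
  -- The sorted rearrangement of `l` is a subsequence of the sorted list `m`, hence within the DP's
  -- search space.
  have hp : l ~ m.filter (fun u => decide (u ∈ l)) := by
    refine (List.perm_ext_iff_of_nodup (G.C_nodup s l hl) (hnd.filter _)).2 fun u => ?_
    simp only [List.mem_filter, decide_eq_true_eq, hm, List.mem_insertionSort, Finset.mem_toList]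
    exact ⟨fun h => ⟨hR u h, h⟩, fun h => h.2⟩
  refine (G.val_le_of_perm_sorted s hp (hsort.filter _)).trans ?_
  exact G.val_le_val_dpAux s m [] _ List.filter_sublist
    (G.C_down s l hl _ hp.symm.subperm)

theorem val_induce (s : V) (R : Finset U) (l : List {u // u ∈ R}) :
    (G.induce R {s}).val ⟨s, Finset.mem_singleton_self s⟩ l = G.val s (l.map Subtype.val) := by
  induction l with
  | nil => simp
  | cons u l ih =>
    rw [List.map_cons, val_cons, val_cons, ih]
    rfl

end value

/-! ### Expectation over independent edge states -/

section expectation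

variable {U V : Type*} [Fintype U] [DecidableEq U] [Fintype V] [DecidableEq V]
  (G : StochasticGraph U V)

theorem expect_mono {f g : (U × V → Bool) → ℝ} (h : ∀ st, f st ≤ g st) :
    G.expect f ≤ G.expect g := by
  refine Finset.sum_le_sum fun st _ => mul_le_mul_of_nonneg_left (h st) ?_
  refine Finset.prod_nonneg fun e _ => ?_
  split_ifs
  · exact G.p_nonneg e
  · linarith [G.p_le_one e]

theorem expect_const (c : ℝ) : G.expect (fun _ => c) = c := by
  rw [expect, ← Finset.sum_mul, sum_prob, one_mul]

theorem expect_const_add (c : ℝ) (f : (U × V → Bool) → ℝ) :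
    G.expect (fun st => c + f st) = c + G.expect f := by
  conv_rhs => rw [← G.expect_const c]
  simp only [expect, mul_add, Finset.sum_add_distrib]

theorem expect_const_mul (c : ℝ) (f : (U × V → Bool) → ℝ) :
    G.expect (fun st => c * f st) = c * G.expect f := by
  simp only [expect, Finset.mul_sum]
  exact Finset.sum_congr rfl fun _ _ => by ring

theorem expect_sum {ι : Type*} (s : Finset ι) (f : ι → (U × V → Bool) → ℝ) :
    G.expect (fun st => ∑ i ∈ s, f i st) = ∑ i ∈ s, G.expect (f i) := by
  simp only [expect, Finset.mul_sum]
  exact Finset.sum_comm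

theorem expect_nonneg {f : (U × V → Bool) → ℝ} (h : ∀ st, 0 ≤ f st) : 0 ≤ G.expect f := by
  rw [← G.expect_const 0]
  exact G.expect_mono h

/-- Conditioning on the state of one edge. -/
theorem expect_split (e : U × V) (f : (U × V → Bool) → ℝ) :
    G.expect f = G.p e * G.expect (fun st => f (Function.update st e true)) +
      (1 - G.p e) * G.expect (fun st => f (Function.update st e false)) := by
  -- The product measure factors into the state of `e` and the states of the other edges, the latter
  -- with weight `W`.
  set φ := (Equiv.funSplitAt e Bool).symm
  set W : ({j // j ≠ e} → Bool) → ℝ :=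
    fun r => ∏ j, if r j = true then G.p j else 1 - G.p j with hW
  have hφ : ∀ b r, φ (b, r) e = b := fun b r => by simp [φ, Equiv.funSplitAt, Equiv.piSplitAt]
  have hφ' : ∀ b r (j : {j // j ≠ e}), φ (b, r) j = r j := fun b r j => by
    simp [φ, Equiv.funSplitAt, Equiv.piSplitAt, j.2]
  have hup : ∀ b c r, Function.update (φ (b, r)) e c = φ (c, r) := by
    intro b c r
    ext j
    by_cases hj : j = e
    · subst hj; simp [hφ]
    · rw [Function.update_of_ne hj, hφ' b r ⟨j, hj⟩, hφ' c r ⟨j, hj⟩]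
  have hprod : ∀ b r, (∏ j, if φ (b, r) j = true then G.p j else 1 - G.p j) =
      (if b = true then G.p e else 1 - G.p e) * W r := by
    intro b r
    rw [Fintype.prod_eq_mul_prod_subtype_ne _ e, hφ]
    simp only [hφ', hW]
  have key : ∀ g : (U × V → Bool) → ℝ, G.expect g =
      G.p e * (∑ r, W r * g (φ (true, r))) + (1 - G.p e) * (∑ r, W r * g (φ (false, r))) := by
    intro g
    rw [expect, ← Equiv.sum_comp φ, Fintype.sum_prod_type, Fintype.sum_bool]
    simp only [hprod, Finset.mul_sum, mul_assoc, if_true, Bool.false_eq_true, if_false]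
  rw [key f, key (fun st => f (Function.update st e true)),
    key (fun st => f (Function.update st e false))]
  simp only [hup]
  ring

/-- The expectation of a function that looks at the state of `e` first, and never again. -/
theorem expect_ite (e : U × V) (f g : (U × V → Bool) → ℝ)
    (hf : ∀ st b, f (Function.update st e b) = f st)
    (hg : ∀ st b, g (Function.update st e b) = g st) :
    G.expect (fun st => if st e = true then f st else g st) =
      G.p e * G.expect f + (1 - G.p e) * G.expect g := by
  rw [expect_split G e]
  simp [hf, hg]

end expectation

/-! ### Probing procedures and the bound at one online vertex -/

section strings

variable {U V : Type*} [DecidableEq V]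

theorem stringAt_append_self (e : U × V) (probed : List (U × V)) :
    stringAt e.2 (probed ++ [e]) = stringAt e.2 probed ++ [e.1] := by
  simp [stringAt]

theorem stringAt_append_of_ne {v : V} {e : U × V} (h : e.2 ≠ v) (probed : List (U × V)) :
    stringAt v (probed ++ [e]) = stringAt v probed := by
  simp [stringAt, h]

theorem mem_stringAt {e : U × V} {probed : List (U × V)} (h : e ∈ probed) :
    e.1 ∈ stringAt e.2 probed := by
  simp only [stringAt, List.mem_map, List.mem_filter, decide_eq_true_eq]
  exact ⟨e, ⟨h, rfl⟩, rfl⟩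

end strings

section probing

variable {U V : Type*} [DecidableEq U] [DecidableEq V] (G : StochasticGraph U V)

/-- An admissible procedure does not probe an edge a second time. -/
theorem run_update {T : ProbeTree U V} {probed : List (U × V)} {M : Finset (U × V)}
    (h : G.Admissible T probed M) {e : U × V} (he : e ∈ probed) (st : U × V → Bool) (b : Bool) :
    T.run (Function.update st e b) = T.run st := by
  induction T generalizing probed M with
  | done => rfl
  | probe f commit a i iha ihi =>
    obtain ⟨h1, -, h3, h4⟩ := h
    -- A second probe would put a repeated entry into a string of `C`.
    have hne : f ≠ e := by
      rintro rfl
      have := G.C_nodup _ _ h1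
      rw [stringAt_append_self, List.nodup_append] at this
      exact this.2.2 _ (mem_stringAt he) _ (by simp) rfl
    simp only [ProbeTree.run, Function.update_of_ne hne]
    rw [iha h3 (by simp [he]), ihi h4 (by simp [he])]

/-- The edges matched by an admissible procedure avoid those matched before. -/
theorem run_disjoint {T : ProbeTree U V} {probed : List (U × V)} {M : Finset (U × V)}
    (h : G.Admissible T probed M) (st : U × V → Bool) {g f : U × V} (hg : g ∈ T.run st)
    (hf : f ∈ M) : f.1 ≠ g.1 ∧ f.2 ≠ g.2 := by
  induction T generalizing probed M with
  | done => simp [ProbeTree.run] at hg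
  | probe e commit a i iha ihi =>
    obtain ⟨-, h2, h3, h4⟩ := h
    simp only [ProbeTree.run] at hg
    split_ifs at hg h3 with hs hc
    · rcases Finset.mem_insert.1 hg with rfl | hg
      · exact h2 hc f hf
      · exact iha h3 hg (by simp [hf])
    · exact iha h3 hg hf
    · exact ihi h4 hg hf
    · exact ihi h4 hg hf

theorem isMatching_run {T : ProbeTree U V} {probed : List (U × V)} {M : Finset (U × V)}
    (h : G.Admissible T probed M) (st : U × V → Bool) : IsMatching (T.run st) := by
  induction T generalizing probed M with
  | done => simp [ProbeTree.run, IsMatching]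
  | probe e commit a i iha ihi =>
    obtain ⟨-, -, h3, h4⟩ := h
    simp only [ProbeTree.run]
    split_ifs at h3 ⊢ with hs hc
    · intro f hf g hg hfg
      rcases Finset.mem_insert.1 hf with rfl | hf' <;>
        rcases Finset.mem_insert.1 hg with rfl | hg'
      · exact absurd rfl hfg
      · exact G.run_disjoint h3 st hg' (by simp)
      · have := G.run_disjoint h3 st hf' (f := g) (by simp)
        exact ⟨this.1.symm, this.2.symm⟩
      · exact iha h3 f hf' g hg' hfg
    · exact iha h3
    · exact ihi h4
    · exact ihi h4

/-- The weight of the edges of `M` in `R × {v}`. -/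
def weightAt (v : V) (R : Finset U) (M : Finset (U × V)) : ℝ :=
  ∑ e ∈ M with e.2 = v ∧ e.1 ∈ R, G.w e

/-- Probe the edges at `v` of a string in order until the first active one, and match it. -/
def chain (v : V) : List U → ProbeTree U V
  | [] => .done
  | u :: l => .probe (u, v) true .done (chain v l)

theorem admissible_chain (v : V) (l : List U) (probed : List (U × V))
    (h : stringAt v probed ++ l ∈ G.C v) : G.Admissible (chain v l) probed ∅ := by
  induction l generalizing probed with
  | nil => trivial
  | cons u l ih =>
    have hs : stringAt v (probed ++ [(u, v)]) = stringAt v probed ++ [u] :=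
      stringAt_append_self (u, v) probed
    refine ⟨?_, by simp, trivial, ih _ ?_⟩
    · change stringAt v (probed ++ [(u, v)]) ∈ G.C v
      rw [hs]
      exact G.C_down v _ h _ (List.Sublist.subperm (by simp))
    · rw [hs]
      simpa using h

variable [Fintype U] [Fintype V]

/-- The expected weight that a procedure collects on `R × {v}` is at most the value of a string
which the probing constraint at `v` still allows. -/
theorem exists_string_weightAt_le (v : V) (R : Finset U) {T : ProbeTree U V}
    {probed : List (U × V)} {M : Finset (U × V)} (h : G.Admissible T probed M)
    (hC : ∀ x, stringAt x probed ∈ G.C x) (hM : ∀ f ∈ M, f.2 ≠ v) :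
    ∃ l : List U, (∀ u ∈ l, u ∈ R) ∧ stringAt v probed ++ l ∈ G.C v ∧
      G.expect (fun st => G.weightAt v R (T.run st)) ≤ G.val v l := by
  induction T generalizing probed M with
  | done =>
    refine ⟨[], by simp, by simpa using hC v, ?_⟩
    simp [ProbeTree.run, weightAt, expect_const]
  | probe e commit a i iha ihi =>
    obtain ⟨h1, h2, h3, h4⟩ := h
    have hC' : ∀ x, stringAt x (probed ++ [e]) ∈ G.C x := by
      intro x
      by_cases hx : e.2 = x
      · exact hx ▸ h1
      · rw [stringAt_append_of_ne hx]; exact hC x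
    -- A continuation allowed after probing `e` is also allowed before, by closure under
    -- subsequences.
    have hdrop : ∀ l, stringAt v (probed ++ [e]) ++ l ∈ G.C v →
        stringAt v probed ++ l ∈ G.C v := by
      intro l hl
      refine G.C_down v _ hl _ (List.Sublist.subperm ?_)
      refine List.Sublist.append ?_ (List.Sublist.refl l)
      by_cases hx : e.2 = v
      · subst hx; rw [stringAt_append_self]; exact List.sublist_append_left _ _
      · rw [stringAt_append_of_ne hx]
    have hE : G.expect (fun st => G.weightAt v R ((ProbeTree.probe e commit a i).run st)) =
        G.p e * G.expect (fun st => G.weightAt v R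
          (if commit = true then insert e (a.run st) else a.run st)) +
        (1 - G.p e) * G.expect (fun st => G.weightAt v R (i.run st)) := by
      rw [← expect_ite]
      · simp only [ProbeTree.run, apply_ite (G.weightAt v R)]
      · intro st b
        rw [G.run_update h3 (by simp)]
      · intro st b
        rw [G.run_update h4 (by simp)]
    obtain ⟨li, hliR, hliC, hli⟩ := ihi h4 hC' hM
    have hp := G.p_nonneg e
    have hp' := sub_nonneg.2 (G.p_le_one e)
    rw [hE]
    have hi := mul_le_mul_of_nonneg_left hli hp'
    -- Committing at `v` saturates it, so the active branch collects there only `e`, and only if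
    -- `e.1 ∈ R`. Otherwise the probe itself adds nothing to the count.
    by_cases hev : commit = true ∧ e.2 = v
    · obtain ⟨hc, rfl⟩ := hev
      simp only [hc, if_true] at h3 ⊢
      have hrun : ∀ st, G.weightAt e.2 R (insert e (a.run st)) =
          if e.1 ∈ R then G.w e else 0 := by
        intro st
        have : (insert e (a.run st)).filter (fun g => g.2 = e.2 ∧ g.1 ∈ R) =
            if e.1 ∈ R then {e} else ∅ := by
          ext g
          have hg : g ∈ a.run st → e.2 ≠ g.2 := fun hg =>
            (G.run_disjoint h3 st hg (by simp)).2
          split_ifs with heR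
          · simp only [Finset.mem_filter, Finset.mem_insert, Finset.mem_singleton]
            exact ⟨fun h => h.1.resolve_right fun hg' => hg hg' h.2.1.symm,
              by rintro rfl; exact ⟨Or.inl rfl, rfl, heR⟩⟩
          · simp only [Finset.mem_filter, Finset.mem_insert, Finset.notMem_empty, iff_false]
            rintro ⟨rfl | hg', h1, h2⟩
            · exact heR h2
            · exact hg hg' h1.symm
        rw [weightAt, this]
        split_ifs <;> simp
      simp only [hrun, expect_const]
      split_ifs with heR
      · refine ⟨e.1 :: li, ?_, ?_, ?_⟩
        · intro u hu
          rcases List.mem_cons.1 hu with rfl | hu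
          · exact heR
          · exact hliR u hu
        · rw [stringAt_append_self] at hliC
          simpa using hliC
        · rw [val_cons]
          linarith
      · refine ⟨li, hliR, hdrop _ hliC, ?_⟩
        have := mul_nonneg hp (G.val_nonneg e.2 li)
        linarith
    · have hrun : ∀ st, G.weightAt v R (if commit = true then insert e (a.run st) else a.run st) =
          G.weightAt v R (a.run st) := by
        intro st
        split_ifs with hc
        · rw [weightAt, Finset.filter_insert, if_neg fun h => hev ⟨hc, h.1⟩, weightAt]
        · rfl
      have hM' : ∀ f ∈ (if commit = true then insert e M else M), f.2 ≠ v := by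
        intro f hf
        split_ifs at hf with hc
        · rcases Finset.mem_insert.1 hf with rfl | hf
          · exact fun h => hev ⟨hc, h⟩
          · exact hM f hf
        · exact hM f hf
      obtain ⟨la, hlaR, hlaC, hla⟩ := iha h3 hC' hM'
      have ha := mul_le_mul_of_nonneg_left hla hp
      simp only [hrun]
      -- The average of the two branches is at most the better one; adaptivity is discarded here.
      rcases le_total (G.val v la) (G.val v li) with hle | hle
      · refine ⟨li, hliR, hdrop _ hliC, ?_⟩
        have := mul_le_mul_of_nonneg_left hle hp
        linarith
      · refine ⟨la, hlaR, hdrop _ hlaC, ?_⟩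
        have := mul_le_mul_of_nonneg_left hle hp'
        linarith

theorem expect_weight_chain (v : V) (l : List U) (probed : List (U × V))
    (h : stringAt v probed ++ l ∈ G.C v) :
    G.expect (fun st => G.weight ((chain v l).run st)) = G.val v l := by
  induction l generalizing probed with
  | nil => simp [chain, ProbeTree.run, weight, expect_const]
  | cons u l ih =>
    have hs : stringAt v (probed ++ [(u, v)]) ++ l ∈ G.C v := by
      rw [show stringAt v (probed ++ [(u, v)]) = stringAt v probed ++ [u] from
        stringAt_append_self (u, v) probed]
      simpa using h
    have hrun : ∀ st, G.weight ((chain v (u :: l)).run st) =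
        if st (u, v) = true then G.w (u, v) else G.weight ((chain v l).run st) := by
      intro st
      simp only [chain, ProbeTree.run]
      split_ifs <;> simp [weight]
    simp only [hrun]
    rw [expect_ite G (u, v) (fun _ => G.w (u, v)), expect_const, ih _ hs, val_cons]
    · simp
    · intro st b
      rw [G.run_update (G.admissible_chain v l _ hs) (by simp)]

theorem performance_le {c : ℝ} (hc : 0 ≤ c)
    (h : ∀ T : G.DetOfflineAlg, G.expect (fun st => G.weight (T.1.run st)) ≤ c)
    (A : PMF G.DetOfflineAlg) : G.performance A ≤ c := by
  have hs : HasSum (fun T => (A T).toReal) 1 := by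
    have h := ENNReal.hasSum_toReal (f := A) (by rw [A.tsum_coe]; simp)
    rwa [← ENNReal.tsum_toReal_eq (fun T => A.apply_ne_top T), A.tsum_coe,
      ENNReal.toReal_one] at h
  have hs' := hs.mul_right c
  rw [one_mul] at hs'
  refine tsum_le_of_sum_le' hc fun F => ?_
  exact le_trans
    (Finset.sum_le_sum fun T _ => mul_le_mul_of_nonneg_left (h T) ENNReal.toReal_nonneg)
    (sum_le_hasSum F (fun T _ => mul_nonneg ENNReal.toReal_nonneg hc) hs')

/-- Randomization does not help: a mixture of deterministic algorithms is bounded by their common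
bound. -/
theorem OPT_le {c : ℝ} (hc : 0 ≤ c)
    (h : ∀ T : G.DetOfflineAlg, G.expect (fun st => G.weight (T.1.run st)) ≤ c) : G.OPT ≤ c :=
  Real.iSup_le (G.performance_le hc h) hc

theorem expect_le_OPT (T : G.DetOfflineAlg) :
    G.expect (fun st => G.weight (T.1.run st)) ≤ G.OPT := by
  -- A deterministic algorithm is a point mass.
  refine le_of_eq_of_le ?_ (le_ciSup G.bddAbove_performance (PMF.pure T))
  rw [performance, tsum_eq_single T]
  · simp
  · intro T' hT'
    simp [hT']

theorem val_le_OPT (v : V) {l : List U} (hl : l ∈ G.C v) : G.val v l ≤ G.OPT := by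
  rw [← G.expect_weight_chain v l [] hl]
  exact G.expect_le_OPT ⟨chain v l, G.admissible_chain v l [] hl⟩

end probing

/-! ### `OPT(s, R)` as a maximum over strings -/

section star

variable {U V : Type*} [DecidableEq U] [DecidableEq V] (G : StochasticGraph U V)

theorem val_le_optStar (s : V) (R : Finset U) {l : List U} (hl : l ∈ G.C s)
    (hR : ∀ u ∈ l, u ∈ R) : G.val s l ≤ G.optStar s R := by
  lift l to List {u // u ∈ R} using hR
  rw [← val_induce]
  exact (G.induce R {s}).val_le_OPT _ hl

theorem optStar_le (s : V) (R : Finset U) {c : ℝ} (hc : 0 ≤ c)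
    (h : ∀ l ∈ G.C s, (∀ u ∈ l, u ∈ R) → G.val s l ≤ c) : G.optStar s R ≤ c := by
  refine OPT_le _ hc fun T => ?_
  set s' : {v // v ∈ ({s} : Finset V)} := ⟨s, Finset.mem_singleton_self s⟩
  obtain ⟨l, -, hlC, hl⟩ := (G.induce R {s}).exists_string_weightAt_le s' Finset.univ T.2
    (fun x => (G.induce R {s}).nil_mem_C x) (by simp)
  rw [val_induce] at hl
  have hall : ∀ M, (G.induce R {s}).weightAt s' Finset.univ M = (G.induce R {s}).weight M := by
    intro M
    rw [weightAt, weight, Finset.filter_true_of_mem]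
    rintro ⟨u, v, hv⟩ -
    exact ⟨Subtype.ext (Finset.mem_singleton.1 hv), Finset.mem_univ _⟩
  simp only [hall] at hl
  refine hl.trans (h _ hlC fun u hu => ?_)
  obtain ⟨x, -, rfl⟩ := List.mem_map.1 hu
  exact x.2

theorem isOptimalString_dpOpt (s : V) (R : Finset U) : G.IsOptimalString s R (G.dpOpt s R) :=
  ⟨G.dpOpt_mem_C s R, G.mem_of_mem_dpOpt s R,
    le_antisymm (G.val_le_optStar s R (G.dpOpt_mem_C s R) (G.mem_of_mem_dpOpt s R))
      (G.optStar_le s R (G.val_nonneg _ _) fun _ => G.val_le_val_dpOpt s R)⟩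

/-- This holds for algorithms on all of `G`: edges away from `v` act only as extra randomness for
the probes at `v`. -/
theorem weightAt_le_optStar [Fintype U] [Fintype V] (v : V) (R : Finset U)
    (T : G.DetOfflineAlg) :
    G.expect (fun st => G.weightAt v R (T.1.run st)) ≤ G.optStar v R := by
  obtain ⟨l, hlR, hlC, hl⟩ := G.exists_string_weightAt_le v R T.2
    (fun x => G.nil_mem_C x) (by simp)
  exact hl.trans (G.val_le_optStar v R hlC hlR)

end star

end StochasticGraph

/-! ### Greedy-DP and the factor one half -/

section greedy

variable {U V : Type*} [DecidableEq U] [DecidableEq V] {D : V → Finset U → List U}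

theorem mem_greedyDP (hD : ∀ v R, ∀ u ∈ D v R, u ∈ R) (st : U × V → Bool) {order : List V}
    {R : Finset U} {e : U × V} (he : e ∈ greedyDP D st order R) :
    e.1 ∈ R ∧ e.2 ∈ order ∧ st e = true := by
  induction order generalizing R with
  | nil => simp [greedyDP] at he
  | cons v vs ih =>
    rw [greedyDP] at he
    split at he
    · have := ih he
      exact ⟨this.1, by simp [this.2.1], this.2.2⟩
    · rename_i u hu
      rcases Finset.mem_insert.1 he with rfl | he
      · exact ⟨hD _ _ _ (List.mem_of_find?_eq_some hu), by simp, by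
          simpa using List.find?_some hu⟩
      · have := ih he
        exact ⟨Finset.mem_of_mem_erase this.1, by simp [this.2.1], this.2.2⟩

theorem isMatching_greedyDP (hD : ∀ v R, ∀ u ∈ D v R, u ∈ R) (st : U × V → Bool)
    {order : List V} (ho : order.Nodup) (R : Finset U) :
    IsMatching (greedyDP D st order R) := by
  induction order generalizing R with
  | nil => simp [greedyDP, IsMatching]
  | cons v vs ih =>
    rw [List.nodup_cons] at ho
    rw [greedyDP]
    split
    · exact ih ho.2 R
    · rename_i u hu
      have key : ∀ g ∈ greedyDP D st vs (R.erase u), u ≠ g.1 ∧ v ≠ g.2 := by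
        intro g hg
        have := mem_greedyDP hD st hg
        exact ⟨(Finset.ne_of_mem_erase this.1).symm, fun h => ho.1 (h ▸ this.2.1)⟩
      intro f hf g hg hfg
      rcases Finset.mem_insert.1 hf with rfl | hf <;> rcases Finset.mem_insert.1 hg with rfl | hg
      · exact absurd rfl hfg
      · exact key g hg
      · exact ⟨(key f hf).1.symm, (key f hf).2.symm⟩
      · exact ih ho.2 _ f hf g hg hfg

/-- Greedy-DP does not look at the edges of online vertices that do not arrive. -/
theorem greedyDP_update (st : U × V → Bool) {order : List V} {e : U × V} (he : e.2 ∉ order)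
    (b : Bool) (R : Finset U) :
    greedyDP D (Function.update st e b) order R = greedyDP D st order R := by
  induction order generalizing R with
  | nil => rfl
  | cons v vs ih =>
    simp only [List.mem_cons, not_or] at he
    have hst : (fun u => Function.update st e b (u, v)) = fun u => st (u, v) := by
      funext u
      exact Function.update_of_ne (by rintro rfl; exact he.1 rfl) _ _
    simp only [greedyDP, hst, ih he.2]

namespace StochasticGraph

variable [Fintype U] [Fintype V] (G : StochasticGraph U V)

/-- If `F` does not look at the edges at `v`, then a lower bound for its expectation conditioned
on the outcome of probing a string at `v` gives one for its expectation. -/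
theorem add_val_le_expect_find? (v : V) {l : List U} (hl : l.Nodup)
    (F : Option U → (U × V → Bool) → ℝ)
    (hF : ∀ o st u b, F o (Function.update st (u, v) b) = F o st) (B c : ℝ)
    (hnone : B ≤ c * G.expect (F none))
    (hsome : ∀ u ∈ l, B + G.w (u, v) ≤ c * G.expect (F (some u))) :
    B + G.val v l ≤ c * G.expect (fun st => F (l.find? fun u => st (u, v)) st) := by
  induction l with
  | nil => simpa using hnone
  | cons u l ih =>
    rw [List.nodup_cons] at hl
    have hfun : (fun st => F ((u :: l).find? fun u => st (u, v)) st) = fun st =>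
        if st (u, v) = true then F (some u) st else F (l.find? fun u => st (u, v)) st := by
      funext st
      by_cases h : st (u, v) = true
      · rw [List.find?_cons_of_pos (by exact h), if_pos h]
      · rw [List.find?_cons_of_neg (by exact h), if_neg h]
    rw [hfun, expect_ite, val_cons]
    · have h1 := mul_le_mul_of_nonneg_left (ih hl.2 fun x hx => hsome x (by simp [hx]))
        (sub_nonneg.2 (G.p_le_one (u, v)))
      have h2 := mul_le_mul_of_nonneg_left (hsome u (by simp)) (G.p_nonneg (u, v))
      linarith
    · exact fun st b => hF _ st u b
    · intro st b
      -- `l` does not contain `u`, so the rest of the search never reads the state of `(u, v)`.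
      have : (l.find? fun x => Function.update st (u, v) b (x, v)) =
          l.find? fun x => st (x, v) := by
        refine List.find?_congr fun x hx => ?_
        exact Function.update_of_ne (fun h => hl.1 (by rwa [(Prod.mk.inj h).1] at hx)) _ _
      rw [this, hF]

/-- Greedy-DP gets at least half of any fractional matching `o` that is bounded by `OPT(v, R)` on
all stars `R × {v}`. -/
theorem sum_le_two_mul_expect_greedyDP {a : U → ℝ} (ha : ∀ u v, G.w (u, v) = a u)
    (hD : ∀ v R, G.IsOptimalString v R (D v R)) (o : U → V → ℝ) (ho : ∀ u v, 0 ≤ o u v)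
    (hstar : ∀ v R, ∑ u ∈ R, a u * o u v ≤ G.optStar v R)
    {order : List V} (hnd : order.Nodup) (hsum : ∀ u, (order.map (o u)).sum ≤ 1)
    (R : Finset U) :
    ∑ u ∈ R, a u * (order.map (o u)).sum ≤
      2 * G.expect (fun st => G.weight (greedyDP D st order R)) := by
  induction order generalizing R with
  | nil => simp [greedyDP, weight, expect_const]
  | cons v vs ih =>
    rw [List.nodup_cons] at hnd
    have hsub : ∀ u, (vs.map (o u)).sum ≤ 1 := fun u => by
      have := hsum u
      rw [List.map_cons, List.sum_cons] at this
      linarith [ho u v]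
    have hDR : ∀ v R, ∀ u ∈ D v R, u ∈ R := fun v R => (hD v R).2.1
    -- Greedy's total weight, given which offline vertex (if any) `v` takes.
    set F : Option U → (U × V → Bool) → ℝ := fun x st => match x with
      | none => G.weight (greedyDP D st vs R)
      | some u => a u + G.weight (greedyDP D st vs (R.erase u)) with hF
    have hgreedy : (fun st => G.weight (greedyDP D st (v :: vs) R)) =
        fun st => F ((D v R).find? fun u => st (u, v)) st := by
      funext st
      rw [greedyDP]
      rcases (D v R).find? fun u => st (u, v) with _ | u
      · rfl
      · simp only [hF, weight]
        rw [Finset.sum_insert fun h => hnd.1 (mem_greedyDP hDR st h).2.1, ha]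
    have hupd : ∀ x st u b, F x (Function.update st (u, v) b) = F x st := by
      intro x st u b
      rcases x with _ | x <;> simp only [hF] <;> rw [greedyDP_update st (by exact hnd.1)]
    rw [hgreedy]
    refine le_trans ?_ (G.add_val_le_expect_find? v (G.C_nodup v _ (hD v R).1) F hupd
      (∑ u ∈ R, a u * (vs.map (o u)).sum) 2 (ih hnd.2 hsub R) ?_)
    · rw [(hD v R).2.2]
      simp only [List.map_cons, List.sum_cons, mul_add, Finset.sum_add_distrib]
      linarith [hstar v R]
    · intro u hu
      simp only [hF]
      -- One copy of `2 * a u` covers the edge just gained, the other the lost later terms of `u`,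
      -- at most `a u` by `hsub`.
      rw [expect_const_add, ha, ← Finset.add_sum_erase R _ (hDR v R u hu)]
      have h0 : 0 ≤ a u := ha u v ▸ G.w_nonneg (u, v)
      have := mul_le_of_le_one_right h0 (hsub u)
      linarith [ih hnd.2 hsub (R.erase u)]

theorem expect_weight_run_le {a : U → ℝ} (ha : ∀ u v, G.w (u, v) = a u)
    (hD : ∀ v R, G.IsOptimalString v R (D v R)) {order : List V} (hnd : order.Nodup)
    (hall : ∀ v, v ∈ order) (T : G.DetOfflineAlg) :
    G.expect (fun st => G.weight (T.1.run st)) ≤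
      2 * G.expect (fun st => G.weight (greedyDP D st order Finset.univ)) := by
  set o : U → V → ℝ := fun u v => G.expect (fun st => if (u, v) ∈ T.1.run st then 1 else 0)
    with ho
  have hord : ∀ u, (order.map (o u)).sum = ∑ v, o u v := by
    intro u
    rw [← List.sum_toFinset _ hnd]
    congr 1
    ext v
    simp [hall v]
  have hsum : ∀ u, (order.map (o u)).sum ≤ 1 := by
    intro u
    rw [hord, ho, ← expect_sum]
    refine G.expect_le _ _ fun st => ?_
    rw [Finset.sum_boole]
    norm_cast
    -- In each outcome `u` has at most one partner.
    refine Finset.card_le_one.2 fun v hv v' hv' => ?_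
    simp only [Finset.mem_filter, Finset.mem_univ, true_and] at hv hv'
    by_contra hne
    exact (G.isMatching_run T.2 st _ hv _ hv' (by simpa using hne)).1 rfl
  have hstar : ∀ v R, ∑ u ∈ R, a u * o u v ≤ G.optStar v R := by
    intro v R
    refine le_of_eq_of_le ?_ (G.weightAt_le_optStar v R T)
    simp only [ho, ← expect_const_mul, ← expect_sum]
    congr 1
    funext st
    simp only [mul_ite, mul_one, mul_zero]
    rw [← Finset.sum_filter, weightAt]
    refine Finset.sum_bij' (fun u _ => (u, v)) (fun e _ => e.1) ?_ ?_ ?_ ?_ ?_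
    · intro u hu
      simp only [Finset.mem_filter] at hu ⊢
      exact ⟨hu.2, trivial, hu.1⟩
    · rintro ⟨u, v'⟩ he
      simp only [Finset.mem_filter] at he ⊢
      obtain ⟨h1, rfl, h3⟩ := he
      exact ⟨h3, h1⟩
    · intro u _
      rfl
    · rintro ⟨u, v'⟩ he
      simp only [Finset.mem_filter] at he
      rw [he.2.1]
    · intro u _
      rw [ha]
  -- By linearity the algorithm's expected weight is the weight of the fractional matching `o`.
  refine le_of_eq_of_le ?_ (G.sum_le_two_mul_expect_greedyDP ha hD o
    (fun u v => G.expect_nonneg fun st => by split_ifs <;> norm_num) hstar hnd hsum Finset.univ)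
  simp only [hord]
  simp only [Finset.mul_sum, ho, ← expect_const_mul, ← expect_sum]
  congr 1
  funext st
  rw [← Fintype.sum_prod_type' (fun u v => a u * if (u, v) ∈ T.1.run st then (1 : ℝ) else 0)]
  simp only [mul_ite, mul_one, mul_zero, weight]
  rw [← Finset.sum_filter, Finset.filter_univ_mem]
  exact Finset.sum_congr rfl fun e _ => ha e.1 e.2

end StochasticGraph

end greedy

end StochMatch

theorem mainTheorem9 {U V : Type*} [Fintype U] [DecidableEq U] [Fintype V] [DecidableEq V]
    (G : StochMatch.StochasticGraph U V) (hG : G.IsVertexWeighted)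
    (order : List V) (horder : order.Nodup) (hall : ∀ v, v ∈ order) :
    (∀ s R, G.IsOptimalString s R (G.dpOpt s R)) ∧
    ∀ D : V → Finset U → List U, (∀ s R, G.IsOptimalString s R (D s R)) →
      (∀ st : U × V → Bool,
        StochMatch.IsMatching (StochMatch.greedyDP D st order Finset.univ) ∧
        ∀ e ∈ StochMatch.greedyDP D st order Finset.univ, st e = true) ∧
      G.OPT / 2 ≤ G.expect (fun st => G.weight (StochMatch.greedyDP D st order Finset.univ)) := by
  obtain ⟨a, ha⟩ := hG
  refine ⟨G.isOptimalString_dpOpt, fun D hD => ⟨fun st => ?_, ?_⟩⟩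
  · have hDR : ∀ v R, ∀ u ∈ D v R, u ∈ R := fun v R => (hD v R).2.1
    exact ⟨StochMatch.isMatching_greedyDP hDR st horder _,
      fun e he => (StochMatch.mem_greedyDP hDR st he).2.2⟩
  · have h0 : 0 ≤ G.expect
        (fun st => G.weight (StochMatch.greedyDP D st order Finset.univ)) :=
      G.expect_nonneg fun st => Finset.sum_nonneg fun e _ => G.w_nonneg e
    have := G.OPT_le (mul_nonneg zero_le_two h0)
      (G.expect_weight_run_le ha hD horder hall)
    linarith
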